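/- Let $a\ge 2$, $N\ge 0$ be integers, $T>0$, and let $\mathcal P\subset\mathbb R^{a-1}$ be a compact set with non-empty interior. Let $F_N:\mathbb R^N\times\mathcal P\to\mathbb R^N$ and $u_{N0}:\mathcal P\to\mathbb R^N$ be continuous, and suppose that for each $\mu\in\mathcal P$ the initial value problem $$\dot u_N=F_N(u_N;\mu),\qquad u_N(0)=u_{N0}(\mu)$$ is well-posed on $[0,T]$, in the sense that it has a solution $u_N(\cdot;\mu)$ on $[0,T]$ and that any two of its solutions on an interval $[0,\tau]$ with $0\le\tau\le T$ coincide. Suppose moreover that the map $(t,\mu)\mapsto u_N(t;\mu)$ is locally injective on $[0,T]\times\mathcal P$: every $(t^*,\mu^*)\in[0,T]\times\mathcal P$ has a radius $r>0$ such that the map is injective on $B_r((t^*,\mu^*))\cap([0,T]\times\mathcal P)$, where $B_r$ denotes the closed ball of radius $r$. Let $$\mathcal M=\{u_N(t;\mu):t\in[0,T],\ \mu\in\mathcal P\}\subset\mathbb R^N$$ be the solution manifold. Then there is a continuous injective encoder $\mathcal M\to\mathbb R^{2a+1}$. Moreover, let the minimal latent dimension of $\mathcal M$ be the least $n\in\mathbb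 N$ for which there are a continuous encoder $\Psi':\mathbb R^N\to\mathbb R^n$ and a continuous decoder $\Psi:\mathbb R^n\to\mathbb R^N$ with $\Psi(\Psi'(x))=x$ for all $x\in\mathcal M$ (lossless compression). This minimum exists and satisfies $n\le 2a+1$. -/

import Mathlib

open Set Metric

/-- `u` solves the autonomous initial value problem `u̇ = f(u)`, `u(0) = x₀` on `[0, τ]`
(with one-sided derivatives at the end points). -/
def IsSolutionOn {N : ℕ} (f : EuclideanSpace ℝ (Fin N) → EuclideanSpace ℝ (Fin N))
    (x₀ : EuclideanSpace ℝ (Fin N)) (τ : ℝ) (u : ℝ → EuclideanSpace ℝ (Fin N)) : Prop :=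
  u 0 = x₀ ∧ IsIntegralCurveOn u (fun _ x => f x) (Icc 0 τ)

/-- Well-posedness of `u̇ = f(u)`, `u(0) = x₀` on `[0, T]`: there is a solution on all of `[0, T]`,
and solutions are unique on every interval `[0, τ]` with `τ ≤ T`. The third clause of Hadamard's
definition, continuous dependence on the data, is a consequence for continuous right-hand sides
and is therefore not demanded; this makes it a weaker hypothesis. -/
structure IsWellPosed {N : ℕ} (f : EuclideanSpace ℝ (Fin N) → EuclideanSpace ℝ (Fin N))
    (x₀ : EuclideanSpace ℝ (Fin N)) (T : ℝ) : Prop where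
  exists_solution : ∃ u, IsSolutionOn f x₀ T u
  unique : ∀ τ ∈ Icc 0 T, ∀ u v, IsSolutionOn f x₀ τ u → IsSolutionOn f x₀ τ v →
    EqOn u v (Icc 0 τ)

/-- The solution manifold `{u(t; μ) : t ∈ [0, T], μ ∈ P}`. -/
def solutionManifold {p N : ℕ} (u : EuclideanSpace ℝ (Fin p) → ℝ → EuclideanSpace ℝ (Fin N))
    (T : ℝ) (P : Set (EuclideanSpace ℝ (Fin p))) : Set (EuclideanSpace ℝ (Fin N)) :=
  {x | ∃ t ∈ Icc 0 T, ∃ μ ∈ P, u μ t = x}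

/-- An autoencoder with latent dimension `n` that reproduces `M` without loss: a continuous encoder
`E : ℝᴺ → ℝⁿ` and a continuous decoder `D : ℝⁿ → ℝᴺ` with `D ∘ E = id` on `M`
(so that `E` is injective on `M`). -/
structure IsLosslessAutoencoder {N n : ℕ} (M : Set (EuclideanSpace ℝ (Fin N)))
    (E : EuclideanSpace ℝ (Fin N) → EuclideanSpace ℝ (Fin n))
    (D : EuclideanSpace ℝ (Fin n) → EuclideanSpace ℝ (Fin N)) : Prop where
  continuous_encoder : Continuous E
  continuous_decoder : Continuous D
  leftInvOn : LeftInvOn D E M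

/-- The latent dimensions in which `M` can be compressed without loss. -/
def losslessLatentDims {N : ℕ} (M : Set (EuclideanSpace ℝ (Fin N))) : Set ℕ :=
  {n | ∃ (E : EuclideanSpace ℝ (Fin N) → EuclideanSpace ℝ (Fin n))
    (D : EuclideanSpace ℝ (Fin n) → EuclideanSpace ℝ (Fin N)), IsLosslessAutoencoder M E D}

/-! The solution map `(t, μ) ↦ u μ t` is continuous on the compact set `[0, T] × P ⊂ ℝ ^ a`, because
uniqueness alone forces continuous dependence on `μ` (`continuousOn_solution`). Hence the manifold
is compact, and by local injectivity it is covered by compact pieces that embed into `ℝ ^ a`.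

The Menger–Nöbeling argument then yields an injection into `ℝ ^ (2 a + 1)`. Maps separating two
disjoint pieces form an open (`isOpen_setOf_separating`) and dense (`dense_setOf_separating`) set,
and Baire's theorem over countably many pairs of pieces gives one map separating all points
(`exists_injective_of_locally_injective`). Density comes from `2 a + 1` staggered grids: a point is
near the walls of at most `a` of them, so any two points share a good coordinate, where the
perturbed map takes values in disjoint lattices.

Finally, Tietze's theorem extends the encoder and its inverse to the whole spaces
(`mem_losslessLatentDims_of_injective`). -/

open Filter Topology

/-! ### Continuous dependence of solutions on the parameter. -/

/-- Mean value inequality for an integral curve of an autonomous field that stays close to `c`. -/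
theorem IsIntegralCurveOn.norm_sub_sub_smul_le {E : Type*} [NormedAddCommGroup E]
    [NormedSpace ℝ E] {u : ℝ → E} {f : E → E} {S : Set ℝ}
    (hu : IsIntegralCurveOn u (fun _ x => f x) S) {s t : ℝ} (hst : uIcc s t ⊆ S) {c : E} {C : ℝ}
    (h : ∀ r ∈ uIcc s t, ‖f (u r) - c‖ ≤ C) :
    ‖u t - u s - (t - s) • c‖ ≤ C * |t - s| := by
  have key := Convex.norm_image_sub_le_of_norm_hasDerivWithin_le
    (f := fun r => u r - r • c) (f' := fun r => f (u r) - c) (s := uIcc s t) (C := C)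
    (x := s) (y := t) (fun r hr => by
      have h1 := (hu r (hst hr)).mono hst
      have h2 := ((hasDerivWithinAt_id r (uIcc s t)).smul_const c)
      rw [one_smul] at h2
      exact h1.sub h2) h (convex_uIcc s t) left_mem_uIcc right_mem_uIcc
  rw [Real.norm_eq_abs] at key
  convert key using 2
  rw [sub_smul]; abel

theorem IsIntegralCurveOn.norm_sub_le {E : Type*} [NormedAddCommGroup E]
    [NormedSpace ℝ E] {u : ℝ → E} {f : E → E} {S : Set ℝ}
    (hu : IsIntegralCurveOn u (fun _ x => f x) S) {s t : ℝ} (hst : uIcc s t ⊆ S) {C : ℝ}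
    (h : ∀ r ∈ uIcc s t, ‖f (u r)‖ ≤ C) :
    ‖u t - u s‖ ≤ C * |t - s| := by
  simpa using hu.norm_sub_sub_smul_le hst (c := 0) (by simpa using h)

theorem IsSolutionOn.continuousOn {N : ℕ} {f : EuclideanSpace ℝ (Fin N) → EuclideanSpace ℝ (Fin N)}
    {x₀ : EuclideanSpace ℝ (Fin N)} {τ : ℝ} {u : ℝ → EuclideanSpace ℝ (Fin N)}
    (hu : IsSolutionOn f x₀ τ u) : ContinuousOn u (Icc 0 τ) :=
  fun t ht => (hu.2 t ht).continuousWithinAt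

theorem abs_min_sub_min_right_le (a b c : ℝ) : |min a c - min b c| ≤ |a - b| := by
  simpa using abs_min_sub_min_le_max a c b c

/-- Solutions that stay bounded up to the times `τ` have the solution of the limiting
problem as their limit at these times. -/
theorem tendsto_solution_sub_of_bounded {p N : ℕ} {T : ℝ}
    {P : Set (EuclideanSpace ℝ (Fin p))} (hP : IsCompact P)
    {F : EuclideanSpace ℝ (Fin N) → EuclideanSpace ℝ (Fin p) → EuclideanSpace ℝ (Fin N)}
    {u₀ : EuclideanSpace ℝ (Fin p) → EuclideanSpace ℝ (Fin N)}
    (hF : ContinuousOn (fun q : EuclideanSpace ℝ (Fin N) × EuclideanSpace ℝ (Fin p) =>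
      F q.1 q.2) (univ ×ˢ P))
    (hu₀ : ContinuousOn u₀ P)
    {u : EuclideanSpace ℝ (Fin p) → ℝ → EuclideanSpace ℝ (Fin N)}
    (hu : ∀ μ ∈ P, IsSolutionOn (fun x => F x μ) (u₀ μ) T (u μ))
    {μ₀ : EuclideanSpace ℝ (Fin p)} (hμ₀ : μ₀ ∈ P)
    (hwp : IsWellPosed (fun x => F x μ₀) (u₀ μ₀) T)
    {l : Ultrafilter (EuclideanSpace ℝ (Fin p))} (hl : (l : Filter _) ≤ 𝓝[P] μ₀)
    {τ : EuclideanSpace ℝ (Fin p) → ℝ} {R : ℝ}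
    (hτ : ∀ᶠ μ in (l : Filter _), τ μ ∈ Icc 0 T)
    (hR : ∀ᶠ μ in (l : Filter _), ∀ t ∈ Icc 0 (τ μ), u μ t ∈ closedBall 0 R) :
    Tendsto (fun μ => u μ (τ μ) - u μ₀ (τ μ)) l (𝓝 0) := by
  have hPl : ∀ᶠ μ in (l : Filter _), μ ∈ P := hl self_mem_nhdsWithin
  obtain ⟨L', hL'⟩ := ((isCompact_closedBall (0 : EuclideanSpace ℝ (Fin N)) R).prod
    hP).exists_bound_of_continuousOn (hF.mono (prod_mono (subset_univ _) subset_rfl))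
  set L := max L' 0
  have hL0 : 0 ≤ L := le_max_right _ _
  have hL : ∀ x ∈ closedBall (0 : EuclideanSpace ℝ (Fin N)) R, ∀ μ ∈ P, ‖F x μ‖ ≤ L :=
    fun x hx μ hμ => (hL' (x, μ) ⟨hx, hμ⟩).trans (le_max_left _ _)
  -- Freezing each solution at time `τ μ` keeps it in one compact ball for all `t ≥ 0`. Pointwise
  -- limits along the ultrafilter then replace Arzelà–Ascoli.
  set w : EuclideanSpace ℝ (Fin p) → ℝ → EuclideanSpace ℝ (Fin N) := fun μ t => u μ (min t (τ μ))
  -- pointwise limits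
  have hv : ∀ t, ∃ x, 0 ≤ t → Tendsto (fun μ => w μ t) l (𝓝 x) := by
    intro t
    by_cases ht : 0 ≤ t
    · obtain ⟨x, -, hx⟩ := isCompact_iff_ultrafilter_le_nhds.1
        (isCompact_closedBall (0 : EuclideanSpace ℝ (Fin N)) R) (l.map fun μ => w μ t) (by
          rw [le_principal_iff, Ultrafilter.mem_coe, Ultrafilter.mem_map, ← Ultrafilter.mem_coe]
          filter_upwards [hR, hτ] with μ h1 h2
          exact h1 _ ⟨le_min ht h2.1, min_le_right _ _⟩)
      exact ⟨x, fun _ => hx⟩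
    · exact ⟨0, fun h => (ht h).elim⟩
  choose v hv using hv
  obtain ⟨σ, hσ, hτσ⟩ := isCompact_iff_ultrafilter_le_nhds.1
    (isCompact_Icc (a := (0 : ℝ)) (b := T)) (l.map τ) (by
      rw [le_principal_iff]; exact hτ)
  change Tendsto τ l (𝓝 σ) at hτσ
  have lip : ∀ᶠ μ in (l : Filter _), ∀ r ∈ Icc 0 (τ μ), ∀ s ∈ Icc 0 (τ μ),
      ‖u μ r - u μ s‖ ≤ L * |r - s| := by
    filter_upwards [hR, hτ, hPl] with μ h1 h2 h3 r hr s hs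
    have hsub : uIcc s r ⊆ Icc 0 (τ μ) := uIcc_subset_Icc hs hr
    exact (hu μ h3).2.norm_sub_le (hsub.trans (Icc_subset_Icc_right h2.2))
      fun r hr => hL _ (h1 r (hsub hr)) μ h3
  have vsol : IsSolutionOn (fun x => F x μ₀) (u₀ μ₀) σ v := by
    constructor
    · refine tendsto_nhds_unique (hv 0 le_rfl) ?_
      refine (((hu₀ μ₀ hμ₀).mono_left hl)).congr' ?_
      filter_upwards [hτ, hPl] with μ h1 h2
      simp only [w, min_eq_left h1.1]
      exact (hu μ h2).1.symm
    · intro s hs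
      rw [hasDerivWithinAt_iff_isLittleO, Asymptotics.isLittleO_iff]
      intro c hc
      have hFc := hF (v s, μ₀) ⟨mem_univ _, hμ₀⟩
      rw [Metric.continuousWithinAt_iff] at hFc
      obtain ⟨δ, hδ, hFδ⟩ := hFc c hc
      -- As `L` does not depend on `μ`, one neighbourhood of `s` serves eventually all `μ`: between
      -- `s` and `t` the solution stays within `δ` of `v s`, and the mean value inequality passes to
      -- the limit.
      have h1 : ∀ᶠ t in 𝓝[Icc 0 σ] s, L * |t - s| < δ / 2 := by
        apply mem_nhdsWithin_of_mem_nhds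
        have : ContinuousAt (fun t => L * |t - s|) s := by fun_prop
        exact this.eventually_lt_const (by simpa using by positivity)
      filter_upwards [h1, self_mem_nhdsWithin] with t ht1 ht
      have hmin : ∀ r ∈ Icc 0 σ, Tendsto (fun μ => min r (τ μ)) l (𝓝 r) := by
        intro r hr
        have := (tendsto_const_nhds (x := r)).min hτσ
        rwa [min_eq_left hr.2] at this
      have lim := (((hv t ht.1).sub (hv s hs.1)).sub
        (((hmin t ht).sub (hmin s hs)).smul_const (F (v s) μ₀))).norm
      refine le_of_tendsto lim ?_
      have hclose : ∀ᶠ μ in (l : Filter _), dist (w μ s) (v s) < δ / 2 :=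
        (hv s hs.1).eventually (ball_mem_nhds _ (half_pos hδ))
      have hμδ : ∀ᶠ μ in (l : Filter _), dist μ μ₀ < δ :=
        hl (mem_nhdsWithin_of_mem_nhds (ball_mem_nhds _ hδ))
      filter_upwards [hclose, hμδ, lip, hτ, hPl] with μ h2 h3 h4 h5 h6
      have hs' : min s (τ μ) ∈ Icc 0 (τ μ) := ⟨le_min hs.1 h5.1, min_le_right _ _⟩
      have ht' : min t (τ μ) ∈ Icc 0 (τ μ) := ⟨le_min ht.1 h5.1, min_le_right _ _⟩
      have hsub := uIcc_subset_Icc hs' ht'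
      have hab := abs_min_sub_min_right_le t s (τ μ)
      refine ((hu μ h6).2.norm_sub_sub_smul_le (hsub.trans (Icc_subset_Icc_right h5.2))
        (C := c) fun r hr => ?_).trans (mul_le_mul_of_nonneg_left hab hc.le)
      rw [← dist_eq_norm]
      refine (hFδ (x := (u μ r, μ)) ⟨mem_univ _, h6⟩ ?_).le
      rw [Prod.dist_eq]
      refine max_lt ?_ h3
      have h7 := h4 r (hsub hr) _ hs'
      have h8 : |r - min s (τ μ)| ≤ |t - s| := (abs_sub_left_of_mem_uIcc hr).trans hab
      have h9 := mul_le_mul_of_nonneg_left h8 hL0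
      calc dist (u μ r) (v s) ≤ dist (u μ r) (w μ s) + dist (w μ s) (v s) := dist_triangle _ _ _
        _ < δ / 2 + δ / 2 := by
          refine add_lt_add ?_ h2
          rw [dist_eq_norm]; exact (h7.trans h9).trans_lt ht1
        _ = δ := by ring
  have husol : IsSolutionOn (fun x => F x μ₀) (u₀ μ₀) σ (u μ₀) :=
    ⟨(hu μ₀ hμ₀).1, fun t ht => ((hu μ₀ hμ₀).2 t ⟨ht.1, ht.2.trans hσ.2⟩).mono
      (Icc_subset_Icc_right hσ.2)⟩
  have heq : v σ = u μ₀ σ := hwp.unique σ hσ v (u μ₀) vsol husol ⟨hσ.1, le_rfl⟩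
  -- `τ μ` may fall on either side of `σ`; the Lipschitz bound closes the gap.
  have e1 : Tendsto (fun μ => u μ (τ μ) - w μ σ) l (𝓝 0) := by
    have hb : Tendsto (fun μ => L * |τ μ - min σ (τ μ)|) l (𝓝 0) := by
      simpa using ((hτσ.sub ((tendsto_const_nhds (x := σ)).min hτσ)).abs).const_mul L
    refine squeeze_zero_norm' ?_ hb
    filter_upwards [lip, hτ] with μ h1 h2
    exact h1 _ ⟨h2.1, le_rfl⟩ _ ⟨le_min hσ.1 h2.1, min_le_right _ _⟩
  have e2 : Tendsto (fun μ => u μ₀ (τ μ)) l (𝓝 (u μ₀ σ)) :=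
    ((hu μ₀ hμ₀).continuousOn σ hσ).tendsto.comp
      (tendsto_nhdsWithin_iff.2 ⟨hτσ, hτ⟩)
  have := (e1.add (hv σ hσ.1)).sub e2
  simpa [heq] using this

/-- Kamke's theorem: unique solvability gives uniform continuous dependence on the parameter. -/
theorem eventually_dist_solution_lt {p N : ℕ} {T : ℝ}
    {P : Set (EuclideanSpace ℝ (Fin p))} (hP : IsCompact P)
    {F : EuclideanSpace ℝ (Fin N) → EuclideanSpace ℝ (Fin p) → EuclideanSpace ℝ (Fin N)}
    {u₀ : EuclideanSpace ℝ (Fin p) → EuclideanSpace ℝ (Fin N)}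
    (hF : ContinuousOn (fun q : EuclideanSpace ℝ (Fin N) × EuclideanSpace ℝ (Fin p) =>
      F q.1 q.2) (univ ×ˢ P))
    (hu₀ : ContinuousOn u₀ P)
    {u : EuclideanSpace ℝ (Fin p) → ℝ → EuclideanSpace ℝ (Fin N)}
    (hu : ∀ μ ∈ P, IsSolutionOn (fun x => F x μ) (u₀ μ) T (u μ))
    {μ₀ : EuclideanSpace ℝ (Fin p)} (hμ₀ : μ₀ ∈ P)
    (hwp : IsWellPosed (fun x => F x μ₀) (u₀ μ₀) T) {ε : ℝ} (hε : 0 < ε) :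
    ∀ᶠ μ in 𝓝[P] μ₀, ∀ t ∈ Icc 0 T, dist (u μ t) (u μ₀ t) < ε := by
  by_contra hcon
  have hcon : ∃ᶠ μ in 𝓝[P] μ₀, ∃ t ∈ Icc 0 T, ε ≤ dist (u μ t) (u μ₀ t) := by
    rw [not_eventually] at hcon
    exact hcon.mono fun μ h => by push Not at h; exact h
  have : NeBot (𝓝[P] μ₀ ⊓ 𝓟 {μ | ∃ t ∈ Icc 0 T, ε ≤ dist (u μ t) (u μ₀ t)}) :=
    frequently_mem_iff_neBot.1 hcon
  set l := Ultrafilter.of (𝓝[P] μ₀ ⊓ 𝓟 {μ | ∃ t ∈ Icc 0 T, ε ≤ dist (u μ t) (u μ₀ t)})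
  have hl' := Ultrafilter.of_le (𝓝[P] μ₀ ⊓ 𝓟 {μ | ∃ t ∈ Icc 0 T, ε ≤ dist (u μ t) (u μ₀ t)})
  have hl : (l : Filter _) ≤ 𝓝[P] μ₀ := hl'.trans inf_le_left
  have hbad : ∀ᶠ μ in (l : Filter _), ∃ t ∈ Icc 0 T, ε ≤ dist (u μ t) (u μ₀ t) :=
    le_principal_iff.1 (hl'.trans inf_le_right)
  have hPl : ∀ᶠ μ in (l : Filter _), μ ∈ P := hl self_mem_nhdsWithin
  have hcont : ∀ μ ∈ P, ContinuousOn (fun t => dist (u μ t) (u μ₀ t)) (Icc 0 T) := fun μ hμ =>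
    continuous_dist.comp_continuousOn ((hu μ hμ).continuousOn.prodMk (hu μ₀ hμ₀).continuousOn)
  have hinit : ∀ᶠ μ in (l : Filter _), dist (u₀ μ) (u₀ μ₀) < ε :=
    hl ((hu₀ μ₀ hμ₀).eventually (ball_mem_nhds _ hε))
  -- Take the first time at distance exactly `ε`: up to then the solution stays in a tube around `u
  -- μ₀`, which supplies the bound that `F` itself does not give.
  have hexit : ∀ μ, ∃ τ, (μ ∈ P ∧ dist (u₀ μ) (u₀ μ₀) < ε ∧
      ∃ t ∈ Icc 0 T, ε ≤ dist (u μ t) (u μ₀ t)) → τ ∈ Icc 0 T ∧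
      dist (u μ τ) (u μ₀ τ) = ε ∧ ∀ t ∈ Icc 0 τ, dist (u μ t) (u μ₀ t) ≤ ε := by
    intro μ
    by_cases h : μ ∈ P ∧ dist (u₀ μ) (u₀ μ₀) < ε ∧ ∃ t ∈ Icc 0 T, ε ≤ dist (u μ t) (u μ₀ t)
    swap
    · exact ⟨0, fun h' => (h h').elim⟩
    obtain ⟨hμ, hi, t₁, ht₁, hεt⟩ := h
    have hcpt : IsCompact (Icc 0 T ∩ (fun t => dist (u μ t) (u μ₀ t)) ⁻¹' {ε}) :=
      isCompact_Icc.of_isClosed_subset ((hcont μ hμ).preimage_isClosed_of_isClosed isClosed_Icc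
        isClosed_singleton) inter_subset_left
    have hi0 : dist (u μ 0) (u μ₀ 0) < ε := by rwa [(hu μ hμ).1, (hu μ₀ hμ₀).1]
    have ivt : ∀ t ∈ Icc 0 T, ε ≤ dist (u μ t) (u μ₀ t) → ∃ r ∈ Icc 0 t,
        dist (u μ r) (u μ₀ r) = ε := fun t ht h =>
      intermediate_value_Icc ht.1 ((hcont μ hμ).mono (Icc_subset_Icc_right ht.2)) ⟨hi0.le, h⟩
    obtain ⟨r, hr, hrε⟩ := ivt t₁ ht₁ hεt
    obtain ⟨τ, ⟨hτ, hτε⟩, hleast⟩ := hcpt.exists_isLeast ⟨r, ⟨hr.1, hr.2.trans ht₁.2⟩, hrε⟩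
    refine ⟨τ, fun _ => ⟨hτ, hτε, fun t ht => ?_⟩⟩
    by_contra! hlt
    obtain ⟨s, hs, hsε⟩ := ivt t ⟨ht.1, ht.2.trans hτ.2⟩ hlt.le
    have : τ ≤ s := hleast ⟨⟨hs.1, hs.2.trans (ht.2.trans hτ.2)⟩, hsε⟩
    have hts : t = τ := le_antisymm ht.2 (this.trans hs.2)
    rw [hts] at hlt
    exact hlt.ne' hτε
  choose τ hτ using hexit
  have hgood : ∀ᶠ μ in (l : Filter _), τ μ ∈ Icc 0 T ∧
      dist (u μ (τ μ)) (u μ₀ (τ μ)) = ε ∧ ∀ t ∈ Icc 0 (τ μ), dist (u μ t) (u μ₀ t) ≤ ε := by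
    filter_upwards [hbad, hPl, hinit] with μ h1 h2 h3 using hτ μ ⟨h2, h3, h1⟩
  obtain ⟨ρ, hρ⟩ := isCompact_Icc.exists_bound_of_continuousOn (hu μ₀ hμ₀).continuousOn
  have lim := tendsto_solution_sub_of_bounded hP hF hu₀ hu hμ₀ hwp hl (τ := τ) (R := ε + ρ)
    (hgood.mono fun μ h => h.1) (by
      filter_upwards [hgood] with μ h t ht
      rw [mem_closedBall]
      refine (dist_triangle _ (u μ₀ t) _).trans (add_le_add (h.2.2 t ht) ?_)
      rw [dist_zero_right]
      exact hρ t ⟨ht.1, ht.2.trans h.1.2⟩)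
  have lim2 : Tendsto (fun _ : EuclideanSpace ℝ (Fin p) => ε) l (𝓝 0) := by
    have := lim.norm
    rw [norm_zero] at this
    refine this.congr' ?_
    filter_upwards [hgood] with μ h
    rw [← dist_eq_norm, h.2.1]
  exact hε.ne (tendsto_nhds_unique lim2 tendsto_const_nhds)

/-- The solution map `(t, μ) ↦ u(t; μ)` is continuous. -/
theorem continuousOn_solution {p N : ℕ} {T : ℝ}
    {P : Set (EuclideanSpace ℝ (Fin p))} (hP : IsCompact P)
    {F : EuclideanSpace ℝ (Fin N) → EuclideanSpace ℝ (Fin p) → EuclideanSpace ℝ (Fin N)}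
    {u₀ : EuclideanSpace ℝ (Fin p) → EuclideanSpace ℝ (Fin N)}
    (hF : ContinuousOn (fun q : EuclideanSpace ℝ (Fin N) × EuclideanSpace ℝ (Fin p) =>
      F q.1 q.2) (univ ×ˢ P))
    (hu₀ : ContinuousOn u₀ P)
    (hwp : ∀ μ ∈ P, IsWellPosed (fun x => F x μ) (u₀ μ) T)
    {u : EuclideanSpace ℝ (Fin p) → ℝ → EuclideanSpace ℝ (Fin N)}
    (hu : ∀ μ ∈ P, IsSolutionOn (fun x => F x μ) (u₀ μ) T (u μ)) :
    ContinuousOn (fun w : ℝ × EuclideanSpace ℝ (Fin p) => u w.2 w.1) (Icc 0 T ×ˢ P) := by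
  rintro ⟨t₀, μ₀⟩ ⟨ht₀, hμ₀⟩
  rw [ContinuousWithinAt, Metric.tendsto_nhds]
  intro ε hε
  have h1 := eventually_dist_solution_lt hP hF hu₀ hu hμ₀ (hwp μ₀ hμ₀) (half_pos hε)
  have h2 : ∀ᶠ t in 𝓝[Icc 0 T] t₀, dist (u μ₀ t) (u μ₀ t₀) < ε / 2 :=
    ((hu μ₀ hμ₀).continuousOn t₀ ht₀).eventually (ball_mem_nhds _ (half_pos hε))
  rw [nhdsWithin_prod_eq]
  filter_upwards [(h2.and self_mem_nhdsWithin).prod_mk h1] with w hw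
  calc dist (u w.2 w.1) (u μ₀ t₀) ≤ dist (u w.2 w.1) (u μ₀ w.1) + dist (u μ₀ w.1) (u μ₀ t₀) :=
        dist_triangle _ _ _
    _ < ε / 2 + ε / 2 := add_lt_add (hw.2 _ hw.1.2) hw.1.1
    _ = ε := add_halves ε

/-! ### Staggered grids and discrete approximation. -/

/-- An integer separating the two numbers would be at distance at least `c` from each, putting them
`2 * c` apart. -/
theorem Int.floor_eq_floor_of_abs_sub_lt {c t t' : ℝ} (ht : ∀ n : ℤ, c ≤ |t - n|)
    (ht' : ∀ n : ℤ, c ≤ |t' - n|) (h : |t - t'| < 2 * c) : ⌊t⌋ = ⌊t'⌋ := by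
  wlog hlt : ⌊t⌋ < ⌊t'⌋ generalizing t t'
  · rcases (not_lt.1 hlt).eq_or_lt with h1 | h1
    · exact h1.symm
    · exact (this ht' ht (by rwa [abs_sub_comm]) h1).symm
  have h1 : t < ⌊t'⌋ := Int.floor_lt.1 hlt
  have h2 := Int.floor_le t'
  have h3 := ht ⌊t'⌋
  have h4 := ht' ⌊t'⌋
  rw [abs_of_nonpos (by linarith)] at h3
  rw [abs_of_nonneg (by linarith)] at h4
  rw [abs_lt] at h
  linarith

/-- Shifts of a number by different multiples of `1 / m` are not both within `1 / (2 m)` of an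
integer. -/
theorem eq_of_abs_shift_sub_lt {m : ℕ} {k k' : Fin m} {t : ℝ} {n n' : ℤ}
    (h : |t + k / m - n| < 1 / (2 * m)) (h' : |t + k' / m - n'| < 1 / (2 * m)) : k = k' := by
  have hm : (0 : ℝ) < m := by exact_mod_cast k.pos
  have h1 : |((k : ℝ) - k') / m - (n - n')| < 1 / m := by
    calc |((k : ℝ) - k') / m - (n - n')| = |(t + k / m - n) - (t + k' / m - n')| := by
          congr 1; ring
      _ ≤ |t + k / m - n| + |t + k' / m - n'| := abs_sub _ _
      _ < 1 / (2 * m) + 1 / (2 * m) := add_lt_add h h'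
      _ = 1 / m := by field_simp; norm_num
  -- Scaling by `m` turns the estimate into one about an integer, which must vanish; so `m` divides
  -- `k - k'`.
  have h2 : |((k : ℤ) - k' - m * (n - n') : ℤ)| < 1 := by
    have : |(((k : ℤ) - k' - m * (n - n') : ℤ) : ℝ)| < 1 := by
      push_cast
      have e : ((k : ℝ) - k' - m * (n - n')) = m * (((k : ℝ) - k') / m - (n - n')) := by
        field_simp
      rw [e, abs_mul, abs_of_pos hm]
      calc _ < (m : ℝ) * (1 / m) := mul_lt_mul_of_pos_left h1 hm
        _ = 1 := by field_simp
    exact_mod_cast this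
  have h3 : (k : ℤ) - k' = m * (n - n') := by
    have := Int.abs_lt_one_iff.1 h2
    linarith
  have hk := k.isLt
  have hk' := k'.isLt
  have h4 : (k : ℤ) - k' = 0 := by
    refine Int.eq_zero_of_abs_lt_dvd ⟨_, h3⟩ ?_
    rw [abs_lt]; omega
  ext; omega

/-- On a compact set that embeds into `ℝ ^ a`, the components of a map to `ℝ ^ m` can be
approximated by functions with values in `δ ℤ + s`, continuous on closed sets such that each point
is missed by at most `a` of these sets. -/
theorem exists_discrete_approximation {Y : Type*} [TopologicalSpace Y] [T2Space Y] {A : Set Y}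
    (hA : IsCompact A) {a m : ℕ} {φ : Y → Fin a → ℝ} (hφ : ContinuousOn φ A)
    (hφi : InjOn φ A) (f : C(Y, Fin m → ℝ)) {δ : ℝ} (hδ : 0 < δ) (s : ℝ) :
    ∃ (A' : Fin m → Set Y) (h : Fin m → Y → ℝ),
      (∀ k, IsClosed (A' k) ∧ A' k ⊆ A ∧ ContinuousOn (h k) (A' k) ∧
        ∀ y ∈ A' k, |h k y - f y k| ≤ 2 * δ ∧ ∃ n : ℤ, h k y = δ * n + s) ∧
      ∀ y ∈ A, ∃ B : Finset (Fin m), B.card ≤ a ∧ ∀ k ∉ B, y ∈ A' k := by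
  classical
  rcases A.eq_empty_or_nonempty with rfl | ⟨y₁, hy₁⟩
  · exact ⟨fun _ => ∅, fun _ _ => 0, by simp, by simp⟩
  obtain ⟨η, hη, hηS⟩ : ∃ η > 0, ∀ x ∈ A, ∀ y ∈ A, dist (φ x) (φ y) < η →
      dist (f x) (f y) < δ := by
    have hfc : Continuous fun q : Y × Y => dist (f q.1) (f q.2) := by fun_prop
    have hS : IsCompact (A ×ˢ A ∩ {q : Y × Y | δ ≤ dist (f q.1) (f q.2)}) :=
      (hA.prod hA).inter_right (isClosed_le continuous_const hfc)
    have hc : ContinuousOn (fun q : Y × Y => dist (φ q.1) (φ q.2)) (A ×ˢ A) :=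
      continuous_dist.comp_continuousOn ((hφ.comp continuousOn_fst fun q hq => hq.1).prodMk
        (hφ.comp continuousOn_snd fun q hq => hq.2))
    obtain ⟨η, hη, h⟩ := hS.exists_forall_le' (a := 0) (hc.mono inter_subset_left) (by
      rintro ⟨x, y⟩ ⟨⟨hx, hy⟩, hxy⟩
      refine dist_pos.2 fun h => ?_
      rw [mem_ofPred_eq, hφi hx hy h, dist_self] at hxy
      exact hδ.not_ge hxy)
    refine ⟨η, hη, fun x hx y hy hxy => ?_⟩
    by_contra! hcon
    exact hxy.not_ge (h (x, y) ⟨⟨hx, hy⟩, hcon⟩)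
  -- The `k`-th grid has mesh `η` and is shifted by `k / m` of a mesh; its walls are where some `t k
  -- y j` is an integer.
  set t : Fin m → Y → Fin a → ℝ := fun k y j => φ y j / η + k / m with ht
  set cell : Fin m → Y → Fin a → ℤ := fun k y j => ⌊t k y j⌋
  have hrep : ∀ k c, ∃ x ∈ A, ∀ y ∈ A, cell k y = c → cell k x = c := by
    intro k c
    by_cases hc : ∃ y ∈ A, cell k y = c
    · obtain ⟨y, hy, hyc⟩ := hc
      exact ⟨y, hy, fun _ _ _ => hyc⟩
    · push Not at hc
      exact ⟨y₁, hy₁, fun y hy h => (hc y hy h).elim⟩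
  choose rep hrepA hrep using hrep
  have htc : ∀ k j, ContinuousOn (fun y => t k y j) A := fun k j =>
    ((continuousOn_pi.1 hφ j).div_const η).add continuousOn_const
  -- Deleting strips around the walls makes the cell locally constant. On each cell, round the value
  -- of `f` at a representative: rounding and oscillation over the cell each cost at most `δ`.
  refine ⟨fun k => A ∩ {y | ∀ j, ∀ n : ℤ, 1 / (2 * m) ≤ |t k y j - n|},
    fun k y => δ * round ((f (rep k (cell k y)) k - s) / δ) + s, fun k => ⟨?_, inter_subset_left,
    ?_, ?_⟩, ?_⟩
  · have : A ∩ {y | ∀ j, ∀ n : ℤ, 1 / (2 * m) ≤ |t k y j - n|} =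
        A ∩ ⋂ j, ⋂ n : ℤ, (A ∩ (fun y => |t k y j - n|) ⁻¹' Ici (1 / (2 * m))) := by
      ext y
      simp only [mem_inter_iff, mem_ofPred_eq, mem_iInter, mem_preimage, mem_Ici]
      exact ⟨fun h => ⟨h.1, fun j n => ⟨h.1, h.2 j n⟩⟩, fun h => ⟨h.1, fun j n => (h.2 j n).2⟩⟩
    change IsClosed (A ∩ {y | ∀ j, ∀ n : ℤ, 1 / (2 * m) ≤ |t k y j - n|})
    rw [this]
    refine hA.isClosed.inter (isClosed_iInter fun j => isClosed_iInter fun n => ?_)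
    exact ((htc k j).sub continuousOn_const).abs.preimage_isClosed_of_isClosed hA.isClosed
      isClosed_Ici
  · intro y₀ hy₀
    have hm : (0 : ℝ) < m := by exact_mod_cast k.pos
    have hev : ∀ᶠ y in 𝓝[A ∩ {y | ∀ j, ∀ n : ℤ, 1 / (2 * m) ≤ |t k y j - n|}] y₀,
        cell k y = cell k y₀ := by
      have h1 : ∀ᶠ y in 𝓝[A ∩ {y | ∀ j, ∀ n : ℤ, 1 / (2 * m) ≤ |t k y j - n|}] y₀,
          ∀ j, dist (t k y j) (t k y₀ j) < 2 * (1 / (2 * m)) := by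
        refine eventually_all.2 fun j => ?_
        exact ((htc k j y₀ hy₀.1).mono inter_subset_left).eventually
          (ball_mem_nhds _ (by positivity))
      filter_upwards [h1, self_mem_nhdsWithin] with y hy hyA
      funext j
      exact Int.floor_eq_floor_of_abs_sub_lt (hyA.2 j) (hy₀.2 j) (hy j)
    refine (continuousWithinAt_const
      (b := δ * round ((f (rep k (cell k y₀)) k - s) / δ) + s)).congr_of_eventuallyEq ?_ rfl
    filter_upwards [hev] with y hy
    rw [hy]
  · intro y hy
    refine ⟨?_, _, rfl⟩
    have hr := abs_sub_round ((f (rep k (cell k y)) k - s) / δ)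
    have h1 : |δ * round ((f (rep k (cell k y)) k - s) / δ) + s - f (rep k (cell k y)) k|
        ≤ δ := by
      have e : δ * round ((f (rep k (cell k y)) k - s) / δ) + s - f (rep k (cell k y)) k =
          -(δ * ((f (rep k (cell k y)) k - s) / δ - round ((f (rep k (cell k y)) k - s) / δ))) := by
        field_simp; ring
      rw [e, abs_neg, abs_mul, abs_of_pos hδ]
      nlinarith
    have h2 : |f (rep k (cell k y)) k - f y k| ≤ δ := by
      have hc : cell k (rep k (cell k y)) = cell k y := hrep k _ y hy.1 rfl
      have := hηS _ (hrepA k (cell k y)) y hy.1 ((dist_pi_lt_iff hη).2 fun j => by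
        have h3 := Int.abs_sub_lt_one_of_floor_eq_floor (congrFun hc j)
        rw [Real.dist_eq]
        have e : t k (rep k (cell k y)) j - t k y j =
            (φ (rep k (cell k y)) j - φ y j) / η := by simp only [ht]; ring
        rwa [e, abs_div, abs_of_pos hη, div_lt_one hη] at h3)
      exact (dist_le_pi_dist _ _ k).trans this.le
    linarith [abs_sub_le (δ * round ((f (rep k (cell k y)) k - s) / δ) + s)
      (f (rep k (cell k y)) k) (f y k)]
  · intro y hy
    refine ⟨Finset.univ.filter fun k => ∃ j, ∃ n : ℤ, |t k y j - n| < 1 / (2 * m), ?_, ?_⟩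
    -- Each bad shift is charged to a coordinate near a wall, and no coordinate is charged twice.
    -- `Option` provides a default, since `Fin a` may be empty.
    · have : ∀ k, ∃ j : Option (Fin a), (∃ j, ∃ n : ℤ, |t k y j - n| < 1 / (2 * m)) →
          ∃ i, j = some i ∧ ∃ n : ℤ, |t k y i - n| < 1 / (2 * m) := by
        intro k
        by_cases h : ∃ j, ∃ n : ℤ, |t k y j - n| < 1 / (2 * m)
        · obtain ⟨j, hj⟩ := h
          exact ⟨some j, fun _ => ⟨j, rfl, hj⟩⟩
        · exact ⟨none, fun h' => (h h').elim⟩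
      choose J hJ using this
      have hcard := Finset.card_le_card_of_injOn
        (s := Finset.univ.filter fun k => ∃ j, ∃ n : ℤ, |t k y j - n| < 1 / (2 * m))
        (t := Finset.univ.image (some : Fin a → Option (Fin a))) J (by
          intro k hk
          obtain ⟨i, hi, -⟩ := hJ k (by simpa using hk)
          simp [hi]) (by
          intro k hk k' hk' hkk
          obtain ⟨i, hi, n, hn⟩ := hJ k (by simpa using hk)
          obtain ⟨i', hi', n', hn'⟩ := hJ k' (by simpa using hk')
          rw [hi, hi', Option.some.injEq] at hkk
          rw [← hkk] at hn'
          exact eq_of_abs_shift_sub_lt hn hn')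
      exact hcard.trans (Finset.card_image_le.trans (by simp))
    · intro k hk
      refine ⟨hy, ?_⟩
      simpa using hk

/-! ### Separating maps and the Baire category argument. -/

/-- The maps that separate two disjoint compact sets form an open set. -/
theorem isOpen_setOf_separating {Y Z : Type*} [TopologicalSpace Y] [LocallyCompactSpace Y]
    [TopologicalSpace Z] [T2Space Z] {A B : Set Y} (hA : IsCompact A) (hB : IsCompact B) :
    IsOpen {f : C(Y, Z) | ∀ x ∈ A, ∀ y ∈ B, f x ≠ f y} := by
  rw [isOpen_iff_eventually]
  intro f hf
  have key : ∀ᶠ g : C(Y, Z) in 𝓝 f, ∀ q ∈ A ×ˢ B, g q.1 ≠ g q.2 := by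
    refine (hA.prod hB).eventually_forall_of_forall_eventually fun q hq => ?_
    have h1 : Continuous fun z : C(Y, Z) × (Y × Y) => z.1 z.2.1 := by fun_prop
    have h2 : Continuous fun z : C(Y, Z) × (Y × Y) => z.1 z.2.2 := by fun_prop
    exact (isOpen_ne_fun h1 h2).mem_nhds (hf q.1 hq.1 q.2 hq.2)
  exact key.mono fun g hg x hx y hy => hg (x, y) ⟨hx, hy⟩

/-- If two disjoint closed sets embed into `ℝ ^ a`, then the maps to `ℝ ^ (2 a + 1)` that separate
them are dense. -/
theorem dense_setOf_separating {Y : Type*} [MetricSpace Y] [CompactSpace Y] {A B : Set Y}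
    (hA : IsClosed A) (hB : IsClosed B) (hAB : Disjoint A B) {a : ℕ} {φ ψ : Y → Fin a → ℝ}
    (hφ : ContinuousOn φ A) (hφi : InjOn φ A) (hψ : ContinuousOn ψ B) (hψi : InjOn ψ B) :
    Dense {f : C(Y, Fin (2 * a + 1) → ℝ) | ∀ x ∈ A, ∀ y ∈ B, f x ≠ f y} := by
  classical
  rw [Metric.dense_iff]
  intro f r hr
  -- The approximation error `2 * δ = r / 2` stays below `r`, and the offsets `0` and `δ / 2` make
  -- the two lattices disjoint.
  have hδ : 0 < r / 4 := by positivity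
  obtain ⟨A', h, hA', hAb⟩ := exists_discrete_approximation hA.isCompact hφ hφi f hδ 0
  obtain ⟨B', h', hB', hBb⟩ :=
    exists_discrete_approximation hB.isCompact hψ hψi f hδ (r / 4 / 2)
  have ext : ∀ k, ∃ g : C(Y, ℝ), (∀ y, |g y| ≤ r / 2) ∧ (∀ y ∈ A' k, g y = h k y - f y k) ∧
      ∀ y ∈ B' k, g y = h' k y - f y k := by
    intro k
    obtain ⟨cA, sA, ctA, vA⟩ := hA' k
    obtain ⟨cB, sB, ctB, vB⟩ := hB' k
    have hfk : ∀ S, ContinuousOn (fun y => f y k) S := fun S =>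
      ((continuous_apply k).comp f.continuous).continuousOn
    set d : Y → ℝ := fun y => if y ∈ A then h k y - f y k else h' k y - f y k
    have dA : ∀ y ∈ A' k, d y = h k y - f y k := fun y hy => if_pos (sA hy)
    have dB : ∀ y ∈ B' k, d y = h' k y - f y k := fun y hy =>
      if_neg fun hyA => disjoint_left.1 hAB hyA (sB hy)
    have hd : ContinuousOn d (A' k ∪ B' k) :=
      (((ctA.sub (hfk _)).congr dA).union_of_isClosed ((ctB.sub (hfk _)).congr dB) cA cB)
    obtain ⟨g, hg, hgr⟩ := ContinuousMap.exists_restrict_eq_forall_mem_of_closed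
      (⟨_, hd.domRestrict⟩ : C(↥(A' k ∪ B' k), ℝ)) (t := Icc (-(r / 2)) (r / 2)) (by
        rintro ⟨y, hy | hy⟩
        · change d y ∈ _
          rw [dA y hy]
          have := abs_le.1 (vA y hy).1
          constructor <;> linarith
        · change d y ∈ _
          rw [dB y hy]
          have := abs_le.1 (vB y hy).1
          constructor <;> linarith) ⟨0, by constructor <;> linarith⟩ (cA.union cB)
    have hgd : ∀ y (hy : y ∈ A' k ∪ B' k), g y = d y := fun y hy =>
      DFunLike.congr_fun hgr (⟨y, hy⟩ : ↥(A' k ∪ B' k))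
    exact ⟨g, fun y => abs_le.2 (hg y), fun y hy => (hgd y (Or.inl hy)).trans (dA y hy),
      fun y hy => (hgd y (Or.inr hy)).trans (dB y hy)⟩
  choose g hgb hgA hgB using ext
  refine ⟨⟨fun y k => f y k + g k y, by fun_prop⟩, ?_, ?_⟩
  · rw [mem_ball, ContinuousMap.dist_lt_iff hr]
    intro y
    rw [dist_pi_lt_iff hr]
    intro k
    rw [Real.dist_eq]
    simpa using (hgb k y).trans_lt (half_lt_self hr)
  · intro x hx y hy hxy
    obtain ⟨b₁, c₁, hb₁⟩ := hAb x hx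
    obtain ⟨b₂, c₂, hb₂⟩ := hBb y hy
    -- Each point spoils at most `a` of the `2 a + 1` coordinates.
    obtain ⟨k, hk⟩ : ∃ k, k ∉ b₁ ∪ b₂ := by
      by_contra! hall
      have h1 : (b₁ ∪ b₂).card = 2 * a + 1 := by
        rw [Finset.eq_univ_iff_forall.2 hall, Finset.card_univ, Fintype.card_fin]
      have h2 := Finset.card_union_le b₁ b₂
      omega
    rw [Finset.notMem_union] at hk
    have hxk := hb₁ k hk.1
    have hyk := hb₂ k hk.2
    obtain ⟨n, hn⟩ := ((hA' k).2.2.2 x hxk).2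
    obtain ⟨n', hn'⟩ := ((hB' k).2.2.2 y hyk).2
    have e : f x k + g k x = f y k + g k y := congrFun hxy k
    rw [hgA k x hxk, hgB k y hyk, hn, hn'] at e
    have e2 : (2 * n : ℝ) = 2 * n' + 1 := by
      have : (r / 8) * (2 * n : ℝ) = (r / 8) * (2 * n' + 1) := by linarith
      exact mul_left_cancel₀ (by positivity) this
    have e3 : 2 * n = 2 * n' + 1 := by exact_mod_cast e2
    omega

/-- A chart of a compact set is transported along a continuous injection. -/
theorem exists_continuousOn_injOn_image {X Y Z : Type*} [TopologicalSpace X] [CompactSpace X]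
    [TopologicalSpace Y] [T2Space Y] [TopologicalSpace Z] [Nonempty X] {φ : X → Z}
    (hφ : Continuous φ) (hφi : Function.Injective φ) {G : X → Y} (hG : Continuous G) {C : Set X}
    (hC : IsClosed C) (hGC : InjOn G C) :
    ∃ ψ : Y → Z, ContinuousOn ψ (G '' C) ∧ InjOn ψ (G '' C) := by
  have hinv : ∀ x ∈ C, Function.invFunOn G C (G x) = x := fun x hx =>
    hGC.leftInvOn_invFunOn hx
  refine ⟨φ ∘ Function.invFunOn G C, ?_, ?_⟩
  -- `G` sends closed subsets of the compact `C` to closed sets, so its inverse is continuous on `G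
  -- '' C`.
  · rw [continuousOn_iff_isClosed]
    intro t ht
    refine ⟨G '' (C ∩ φ ⁻¹' t),
      ((hC.inter (ht.preimage hφ)).isCompact.image hG).isClosed, ?_⟩
    ext y
    constructor
    · rintro ⟨hy, x, hx, rfl⟩
      rw [mem_preimage, Function.comp_apply, hinv x hx] at hy
      exact ⟨⟨x, ⟨hx, hy⟩, rfl⟩, x, hx, rfl⟩
    · rintro ⟨⟨x, ⟨hx, hxt⟩, rfl⟩, h⟩
      refine ⟨?_, h⟩
      rwa [mem_preimage, Function.comp_apply, hinv x hx]
  · rintro _ ⟨x, hx, rfl⟩ _ ⟨y, hy, rfl⟩ hxy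
    have := hφi hxy
    rw [hinv x hx, hinv y hy] at this
    rw [this]

/-- Embedding theorem of Menger and Nöbeling for the image of a compact subset of `ℝ ^ a` under a
continuous, locally injective map. -/
theorem exists_injective_of_locally_injective {X Y : Type*} [MetricSpace X] [CompactSpace X]
    [MetricSpace Y] [CompactSpace Y] {a : ℕ} {φ : X → Fin a → ℝ} (hφ : Continuous φ)
    (hφi : Function.Injective φ) {G : X → Y} (hG : Continuous G) (hGs : Function.Surjective G)
    (hGi : ∀ x, ∃ U ∈ 𝓝 x, InjOn G U) :
    ∃ e : C(Y, Fin (2 * a + 1) → ℝ), Function.Injective e := by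
  rcases isEmpty_or_nonempty X with hX | hX
  · have : IsEmpty Y := ⟨fun y => hX.elim (hGs y).choose⟩
    exact ⟨0, Function.injective_of_subsingleton _⟩
  let 𝓑 := TopologicalSpace.countableBasis X
  have h𝓑 : TopologicalSpace.IsTopologicalBasis 𝓑 := TopologicalSpace.isBasis_countableBasis X
  -- Only countably many pairs occur, yet any two distinct points of `Y` lie in the images of such a
  -- pair.
  let ι := {p : 𝓑 × 𝓑 // InjOn G (closure p.1) ∧ InjOn G (closure p.2) ∧
    Disjoint (G '' closure (p.1 : Set X)) (G '' closure (p.2 : Set X))}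
  have hcl : ∀ S : Set X, IsClosed (G '' closure S) := fun S =>
    (isClosed_closure.isCompact.image hG).isClosed
  let S : ι → Set C(Y, Fin (2 * a + 1) → ℝ) := fun i =>
    {f | ∀ x ∈ G '' closure (i.1.1 : Set X), ∀ y ∈ G '' closure (i.1.2 : Set X), f x ≠ f y}
  have hdense : Dense (⋂ i, S i) := by
    refine dense_iInter_of_isOpen (fun i => isOpen_setOf_separating (hcl _).isCompact
      (hcl _).isCompact) fun i => ?_
    obtain ⟨φ', h1, h2⟩ := exists_continuousOn_injOn_image hφ hφi hG isClosed_closure i.2.1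
    obtain ⟨ψ', h3, h4⟩ := exists_continuousOn_injOn_image hφ hφi hG isClosed_closure i.2.2.1
    exact dense_setOf_separating (hcl _) (hcl _) i.2.2.2 h1 h2 h3 h4
  obtain ⟨e, he⟩ := hdense.nonempty
  refine ⟨e, fun y y' hyy => ?_⟩
  by_contra hne
  obtain ⟨x, rfl⟩ := hGs y
  obtain ⟨x', rfl⟩ := hGs y'
  obtain ⟨V, hV, V', hV', hVV⟩ := t2_separation_nhds hne |>.imp fun V h => by
    obtain ⟨V', h1, h2, h3⟩ := h
    exact (⟨h1, V', h2, h3⟩ : V ∈ 𝓝 (G x) ∧ ∃ V', V' ∈ 𝓝 (G x') ∧ Disjoint V V')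
  obtain ⟨U, hU, hUi⟩ := hGi x
  obtain ⟨U', hU', hUi'⟩ := hGi x'
  obtain ⟨b, hb, hxb, hbs⟩ := h𝓑.exists_closure_subset
    (inter_mem hU (hG.continuousAt.preimage_mem_nhds hV))
  obtain ⟨b', hb', hxb', hbs'⟩ := h𝓑.exists_closure_subset
    (inter_mem hU' (hG.continuousAt.preimage_mem_nhds hV'))
  have hi := mem_iInter.1 he ⟨(⟨b, hb⟩, ⟨b', hb'⟩), hUi.mono fun z hz => (hbs hz).1,
    hUi'.mono fun z hz => (hbs' hz).1,
    hVV.mono (image_subset_iff.2 fun z hz => (hbs hz).2)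
      (image_subset_iff.2 fun z hz => (hbs' hz).2)⟩
  exact hi _ ⟨x, subset_closure hxb, rfl⟩ _ ⟨x', subset_closure hxb', rfl⟩ hyy
-- Lossless compression and the main theorem.
/-- A compact set is compressed without loss by every continuous injection. -/
theorem mem_losslessLatentDims_of_injective {N n : ℕ} {M : Set (EuclideanSpace ℝ (Fin N))}
    (hM : IsCompact M) {E : M → EuclideanSpace ℝ (Fin n)} (hE : Continuous E)
    (hEi : Function.Injective E) : n ∈ losslessLatentDims M := by
  have : CompactSpace M := isCompact_iff_compactSpace.1 hM
  obtain ⟨E', hE'⟩ := ContinuousMap.exists_restrict_eq hM.isClosed ⟨E, hE⟩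
  -- The inverse of `E` is continuous on a closed subset of `ℝ ^ n`, so Tietze's theorem extends it
  -- to a decoder.
  obtain ⟨D, hD⟩ := ContinuousMap.exists_extension' (hE.isClosedEmbedding hEi)
    (⟨Subtype.val, continuous_subtype_val⟩ : C(M, EuclideanSpace ℝ (Fin N)))
  refine ⟨E', D, E'.continuous, D.continuous, fun x hx => ?_⟩
  have h1 : E' x = E ⟨x, hx⟩ := DFunLike.congr_fun hE' (⟨x, hx⟩ : M)
  rw [h1]
  exact congrFun hD ⟨x, hx⟩

theorem mainTheorem3 (a N : ℕ) (ha : 2 ≤ a) (T : ℝ) (hT : 0 < T)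
    (P : Set (EuclideanSpace ℝ (Fin (a - 1)))) (hP : IsCompact P) (hPint : (interior P).Nonempty)
    (F : EuclideanSpace ℝ (Fin N) → EuclideanSpace ℝ (Fin (a - 1)) → EuclideanSpace ℝ (Fin N))
    (u₀ : EuclideanSpace ℝ (Fin (a - 1)) → EuclideanSpace ℝ (Fin N))
    (hF : ContinuousOn (fun q : EuclideanSpace ℝ (Fin N) × EuclideanSpace ℝ (Fin (a - 1)) =>
      F q.1 q.2) (univ ×ˢ P))
    (hu₀ : ContinuousOn u₀ P)
    (hwp : ∀ μ ∈ P, IsWellPosed (fun x => F x μ) (u₀ μ) T)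
    (u : EuclideanSpace ℝ (Fin (a - 1)) → ℝ → EuclideanSpace ℝ (Fin N))
    (hu : ∀ μ ∈ P, IsSolutionOn (fun x => F x μ) (u₀ μ) T (u μ))
    (hinj : ∀ z ∈ Icc (0 : ℝ) T ×ˢ P, ∃ r > 0,
      InjOn (fun w : ℝ × EuclideanSpace ℝ (Fin (a - 1)) => u w.2 w.1)
        (closedBall z r ∩ Icc (0 : ℝ) T ×ˢ P)) :
    (∃ E : solutionManifold u T P → EuclideanSpace ℝ (Fin (2 * a + 1)),
      Continuous E ∧ Function.Injective E) ∧
    ∃ n : ℕ, IsLeast (losslessLatentDims (solutionManifold u T P)) n ∧ n ≤ 2 * a + 1 := by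
  classical
  set S : Set (ℝ × EuclideanSpace ℝ (Fin (a - 1))) := Icc (0 : ℝ) T ×ˢ P
  have hS : IsCompact S := isCompact_Icc.prod hP
  have hcont : ContinuousOn (fun w : ℝ × EuclideanSpace ℝ (Fin (a - 1)) => u w.2 w.1) S :=
    continuousOn_solution hP hF hu₀ hwp hu
  have himg : solutionManifold u T P =
      (fun w : ℝ × EuclideanSpace ℝ (Fin (a - 1)) => u w.2 w.1) '' S := by
    ext x
    constructor
    · rintro ⟨t, ht, μ, hμ, rfl⟩
      exact ⟨(t, μ), ⟨ht, hμ⟩, rfl⟩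
    · rintro ⟨⟨t, μ⟩, ⟨ht, hμ⟩, rfl⟩
      exact ⟨t, ht, μ, hμ, rfl⟩
  have hM : IsCompact (solutionManifold u T P) := himg ▸ hS.image_of_continuousOn hcont
  have : CompactSpace S := isCompact_iff_compactSpace.1 hS
  have : CompactSpace (solutionManifold u T P) := isCompact_iff_compactSpace.1 hM
  let G : S → solutionManifold u T P := fun w =>
    ⟨u w.1.2 w.1.1, w.1.1, w.2.1, w.1.2, w.2.2, rfl⟩
  have hG : Continuous G := hcont.domRestrict.subtype_mk _
  have hGs : Function.Surjective G := by
    rintro ⟨_, t, ht, μ, hμ, rfl⟩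
    exact ⟨⟨(t, μ), ht, hμ⟩, rfl⟩
  have hGi : ∀ w, ∃ U ∈ 𝓝 w, InjOn G U := by
    rintro ⟨w, hw⟩
    obtain ⟨r, hr, hinj⟩ := hinj w hw
    refine ⟨closedBall ⟨w, hw⟩ r, closedBall_mem_nhds _ hr, fun x hx y hy hxy => ?_⟩
    exact Subtype.ext (hinj ⟨hx, x.2⟩ ⟨hy, y.2⟩ (congrArg Subtype.val hxy))
  -- Time and parameter together have dimension `1 + (a - 1) = a`.
  let L : (ℝ × EuclideanSpace ℝ (Fin (a - 1))) ≃L[ℝ] (Fin a → ℝ) :=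
    ContinuousLinearEquiv.ofFinrankEq (by simp; omega)
  obtain ⟨e, he⟩ := exists_injective_of_locally_injective
    (L.continuous.comp continuous_subtype_val) (L.injective.comp Subtype.val_injective) hG hGs hGi
  let E : solutionManifold u T P → EuclideanSpace ℝ (Fin (2 * a + 1)) := fun x =>
    WithLp.toLp 2 (e x)
  have hE : Continuous E := (PiLp.continuous_toLp 2 _).comp e.continuous
  have hEi : Function.Injective E := (WithLp.toLp_injective 2).comp he
  have hmem : 2 * a + 1 ∈ losslessLatentDims (solutionManifold u T P) :=
    mem_losslessLatentDims_of_injective hM hE hEi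
  exact ⟨⟨E, hE, hEi⟩, Nat.find ⟨_, hmem⟩,
    ⟨Nat.find_spec ⟨_, hmem⟩, fun n hn => Nat.find_min' ⟨_, hmem⟩ hn⟩,
    Nat.find_min' ⟨_, hmem⟩ hmem⟩
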